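/- Let $\mathcal H$ be a separable complex Hilbert space. A conjugation on $\mathcal H$ is a conjugate-linear map $C:\mathcal H\to\mathcal H$ with $C^2=I$ and $\langle Cx,Cy\rangle=\langle y,x\rangle$ for all $x,y\in\mathcal H$. A bounded linear operator $T$ on $\mathcal H$ is called complex symmetric if $CTC=T^*$ for some conjugation $C$ on $\mathcal H$; it is called irreducible if the only orthogonal projections commuting with $T$ are $0$ and $I$; and it is called a weighted shift if there are an orthonormal basis $\{e_i\}$ of $\mathcal H$, indexed by the positive integers (unilateral case) or by all integers (bilateral case), and complex numbers $\{w_i\}$ such that $Te_i=w_ie_{i+1}$ for all $i$. Let $T$ be a bounded linear operator on $\mathcal H$ that is complex symmetric and a (unilateral or bilateral) weighted shift. Then for every $\varepsilon>0$ there exists a compact operator $K$ on $\mathcal H$ with $\|K\|<\varepsilon$ such that $T+K$ is complex symmetric and irreducible. -/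

import Mathlib

open scoped ComplexConjugate InnerProductSpace

namespace CSO

section

variable {H : Type*} [NormedAddCommGroup H] [InnerProductSpace ℂ H]

/-- A conjugation: a conjugate-linear map `C` with `C ∘ C = id` and `⟪C x, C y⟫ = ⟪y, x⟫`. -/
structure IsConjugation (C : H →ₗ⋆[ℂ] H) : Prop where
  involutive : ∀ x, C (C x) = x
  inner_map_map : ∀ x y, ⟪C x, C y⟫_ℂ = ⟪y, x⟫_ℂ

/-- Unilateral weighted shift: `T e_i = w_i e_{i+1}` for an orthonormal basis indexed by
`0, 1, 2, …` (the index is shifted by one from `1, 2, 3, …`) and arbitrary complex weights. -/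
def IsUnilateralWeightedShift (T : H →L[ℂ] H) : Prop :=
  ∃ (e : HilbertBasis ℕ ℂ H) (w : ℕ → ℂ), ∀ i, T (e i) = w i • e (i + 1)

/-- Bilateral weighted shift: `T e_i = w_i e_{i+1}` for an orthonormal basis indexed by `ℤ`
and arbitrary complex weights. -/
def IsBilateralWeightedShift (T : H →L[ℂ] H) : Prop :=
  ∃ (e : HilbertBasis ℤ ℂ H) (w : ℤ → ℂ), ∀ i, T (e i) = w i • e (i + 1)

/-- Weighted shift, unilateral or bilateral. -/
def IsWeightedShift (T : H →L[ℂ] H) : Prop :=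
  IsUnilateralWeightedShift T ∨ IsBilateralWeightedShift T

variable [CompleteSpace H]

/-- `T` is complex symmetric if `C T C = T*` for some conjugation `C`. -/
def IsComplexSymmetric (T : H →L[ℂ] H) : Prop :=
  ∃ C : H →ₗ⋆[ℂ] H, IsConjugation C ∧ ∀ x, C (T (C x)) = ContinuousLinearMap.adjoint T x

/-- `T` is irreducible if the only orthogonal projections commuting with `T` are `0` and `1`. -/
def IsIrreducible (T : H →L[ℂ] H) : Prop :=
  ∀ P : H →L[ℂ] H, IsStarProjection P → Commute P T → P = 0 ∨ P = 1

end

end CSO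

namespace CSO

variable {H : Type*} [NormedAddCommGroup H] [InnerProductSpace ℂ H]

/-! ### Conjugations and the operators commuting with them -/

section Conjugation

variable {C : H →ₗ⋆[ℂ] H}

/-! The shift structure enters only through its countable orthonormal basis, which makes the space
separable; the rest is a Baire category argument for any `C`-symmetric `T`. The compact
`C`-symmetric operators `K` form a complete metric space. For a real vector `x` (`C x = x`), a
vector `y` and `n`, consider those `K` for which every self-adjoint contraction commuting with `T +
K` has `eigenDefect` at `x, y` below `1 / (n + 1)`. This set is open by weak compactness of
contractions (`isOpen_eigenDefect_lt`). It is dense because a small perturbation makes `x` an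
eigenvector of every self-adjoint operator commuting with the sum
(`exists_compact_perturbation_eigenvector`). For that density, write the operator as `A + iB` with
`A`, `B` real self-adjoint. Perturb `A` so that `x` is a finite sum of orthogonal simple
eigenvectors `y k`; then add to `B` a small multiple of the rank-one operator of `x`, coupling all
nonzero `y k`. A commuting self-adjoint operator is diagonal on the `y k`, and the coupling equates
its eigenvalues. A `K` near `0` in all these sets, for a dense sequence of vectors, works: a
projection commuting with `T + K` has every real vector as an eigenvector, hence is `0` or `1`. -/

lemma IsConjugation.norm_map (hC : IsConjugation C) (x : H) : ‖C x‖ = ‖x‖ := by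
  rw [@norm_eq_sqrt_re_inner ℂ, @norm_eq_sqrt_re_inner ℂ, hC.inner_map_map]

lemma IsConjugation.continuous (hC : IsConjugation C) : Continuous C :=
  (AddMonoidHomClass.isometry_of_norm C hC.norm_map).continuous

lemma IsConjugation.inner_map_left (hC : IsConjugation C) (x y : H) :
    ⟪C x, y⟫_ℂ = ⟪C y, x⟫_ℂ := by
  rw [← hC.inner_map_map, hC.involutive]

/-- The operator `C X C`. -/
def IsConjugation.conj (hC : IsConjugation C) (X : H →L[ℂ] H) : H →L[ℂ] H where
  toFun x := C (X (C x))
  map_add' x y := by simp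
  map_smul' c x := by simp
  cont := hC.continuous.comp (X.continuous.comp hC.continuous)

@[simp]
lemma IsConjugation.conj_apply (hC : IsConjugation C) (X : H →L[ℂ] H) (x : H) :
    hC.conj X x = C (X (C x)) := rfl

/-- The operator `X` commutes with `C`, i.e. it is real with respect to `C`. -/
def IsReal (C : H →ₗ⋆[ℂ] H) (X : H →L[ℂ] H) : Prop :=
  ∀ x, C (X x) = X (C x)

lemma IsReal.add {X Y : H →L[ℂ] H} (hX : IsReal C X) (hY : IsReal C Y) : IsReal C (X + Y) :=
  fun x => by simp [hX x, hY x]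

lemma IsReal.sub {X Y : H →L[ℂ] H} (hX : IsReal C X) (hY : IsReal C Y) : IsReal C (X - Y) :=
  fun x => by simp [hX x, hY x]

lemma IsReal.neg {X : H →L[ℂ] H} (hX : IsReal C X) : IsReal C (-X) :=
  fun x => by simp [hX x]

lemma IsReal.mul {X Y : H →L[ℂ] H} (hX : IsReal C X) (hY : IsReal C Y) : IsReal C (X * Y) :=
  fun x => by simp [hX _, hY x]

lemma isReal_one : IsReal C (1 : H →L[ℂ] H) := fun x => by simp

lemma map_real_smul (r : ℝ) (x : H) : C (r • x) = r • C x := by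
  rw [← Complex.coe_smul, map_smulₛₗ]; simp

lemma IsReal.smul {X : H →L[ℂ] H} (hX : IsReal C X) (r : ℝ) : IsReal C (r • X) :=
  fun x => by simp [hX x, map_real_smul]

lemma IsReal.sum {ι : Type*} {s : Finset ι} {X : ι → H →L[ℂ] H} (hX : ∀ i ∈ s, IsReal C (X i)) :
    IsReal C (∑ i ∈ s, X i) :=
  fun x => by simpa using Finset.sum_congr rfl fun i hi => hX i hi x

open ContinuousLinearMap in
lemma IsConjugation.conj_nonneg (hC : IsConjugation C) {X : H →L[ℂ] H} (hX : 0 ≤ X) :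
    0 ≤ hC.conj X := by
  rw [nonneg_iff_isPositive] at hX ⊢
  rw [isPositive_iff_complex]
  intro x
  have h := (isPositive_iff_complex X).1 hX (C x)
  have : ⟪hC.conj X x, x⟫_ℂ = ⟪C x, X (C x)⟫_ℂ := by
    rw [hC.conj_apply, hC.inner_map_left]
  rw [this, ← hX.inner_left_eq_inner_right]
  exact h

/-- `C` preserves `N` and so also its orthogonal complement; hence it carries the decomposition of
`v` to that of `C v`. -/
lemma isReal_starProjection (hC : IsConjugation C) (N : Submodule ℂ H) [N.HasOrthogonalProjection]
    (hN : ∀ v ∈ N, C v ∈ N) : IsReal C N.starProjection := by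
  intro v
  refine (Submodule.eq_starProjection_of_mem_of_inner_eq_zero
    (hN _ (Submodule.starProjection_apply_mem N v)) ?_).symm
  intro w hw
  rw [← map_sub, hC.inner_map_left, ← inner_conj_symm]
  rw [Submodule.starProjection_inner_eq_zero v (C w) (hN w hw), map_zero]

end Conjugation

/-! ### Refining a resolution of the identity by a symmetry -/

section HalfSum

variable {R : Type*} [Ring R] [Algebra ℝ R]

/-- The element `(1 ± S) / 2`, a spectral idempotent of `S` if `S ^ 2 = 1`. -/
noncomputable def halfSum (S : R) (b : Bool) : R := (1 / 2 : ℝ) • (1 + cond b S (-S))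

lemma _root_.Commute.halfSum_left {S X : R} (h : Commute S X) (b : Bool) :
    Commute (halfSum S b) X := by
  refine Commute.smul_left ((Commute.one_left X).add_left ?_) _
  cases b
  exacts [h.neg_left, h]

lemma halfSum_mul_halfSum {S : R} (hS : S * S = 1) (b c : Bool) :
    halfSum S b * halfSum S c = if b = c then halfSum S b else 0 := by
  cases b <;> cases c <;> simp [halfSum, mul_add, add_mul, hS] <;> module

lemma halfSum_add_halfSum (S : R) : halfSum S true + halfSum S false = 1 := by
  simp only [halfSum, cond]
  module

/-- Each idempotent splits along the `±1` parts of `S`; shifting coefficients by `±r` on the two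
parts adds exactly `r • S`. This is the inductive step of the spectral approximation. -/
lemma _root_.CompleteOrthogonalIdempotents.halfSum {ι : Type*} [Fintype ι] {E : ι → R}
    (hE : CompleteOrthogonalIdempotents E) {S : R} (hS : S * S = 1)
    (hES : ∀ k, Commute (E k) S) :
    CompleteOrthogonalIdempotents (fun p : ι × Bool => E p.1 * CSO.halfSum S p.2) ∧
      ∀ (t : ι → ℝ) (r : ℝ), ∑ p : ι × Bool, (t p.1 + cond p.2 r (-r)) • (E p.1 * CSO.halfSum S p.2)
        = ∑ k, t k • E k + r • S := by
  have hGE : ∀ b k, Commute (CSO.halfSum S b) (E k) := fun b k => (hES k).symm.halfSum_left b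
  refine ⟨⟨⟨?_, ?_⟩, ?_⟩, ?_⟩
  · rintro ⟨k, b⟩
    change E k * CSO.halfSum S b * (E k * CSO.halfSum S b) = E k * CSO.halfSum S b
    rw [mul_assoc, ← mul_assoc (CSO.halfSum S b), (hGE b k).eq, mul_assoc,
      halfSum_mul_halfSum hS, if_pos rfl, ← mul_assoc, (hE.idem k).eq]
  · rintro ⟨k, b⟩ ⟨l, c⟩ h
    change E k * CSO.halfSum S b * (E l * CSO.halfSum S c) = 0
    rw [mul_assoc, ← mul_assoc (CSO.halfSum S b), (hGE b l).eq, mul_assoc, ← mul_assoc]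
    by_cases hkl : k = l
    · have : b ≠ c := fun hbc => h (by rw [hkl, hbc])
      rw [halfSum_mul_halfSum hS, if_neg this, mul_zero]
    · rw [hE.ortho hkl, zero_mul]
  · rw [Fintype.sum_prod_type]
    simp only [Fintype.sum_bool, ← mul_add, halfSum_add_halfSum, mul_one]
    exact hE.complete
  · intro t r
    have h1 : ∀ k, (t k + r) • (E k * CSO.halfSum S true) +
        (t k + -r) • (E k * CSO.halfSum S false) = t k • E k + r • (E k * S) := by
      intro k
      simp only [CSO.halfSum, mul_smul_comm, mul_add, mul_one, cond, mul_neg]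
      module
    rw [Fintype.sum_prod_type]
    simp only [Fintype.sum_bool, cond, h1]
    rw [Finset.sum_add_distrib, ← Finset.smul_sum, ← Finset.sum_mul, hE.complete, one_mul]

end HalfSum

/-! ### Spectral approximation compatible with the conjugation -/

section Spectral

variable [CompleteSpace H] {C : H →ₗ⋆[ℂ] H}

open ContinuousLinearMap

lemma commute_starProjection {X : H →L[ℂ] H} (hX : IsSelfAdjoint X) (N : Submodule ℂ H)
    [N.HasOrthogonalProjection] (hN : ∀ v ∈ N, X v ∈ N) : Commute X N.starProjection := by
  have hF : IsSelfAdjoint N.starProjection := isSelfAdjoint_starProjection N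
  have h1 : N.starProjection * X * N.starProjection = X * N.starProjection := by
    ext v
    exact Submodule.starProjection_eq_self_iff.2 (hN _ (Submodule.starProjection_apply_mem N v))
  have h2 := congrArg star h1
  simp only [star_mul, hF.star_eq, hX.star_eq] at h2
  change X * _ = _ * X
  rw [← h1, mul_assoc, h2]

/-- Conjugating `A⁺` and `A⁻` by `C` again gives nonnegative operators with product zero and
difference `A`, so uniqueness of this decomposition applies. -/
lemma IsReal.posPart (hC : IsConjugation C) {A : H →L[ℂ] H} (hA : IsSelfAdjoint A)
    (h : IsReal C A) : IsReal C A⁺ := by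
  have key := (CFC.posPart_negPart_unique (a := A) (b := hC.conj A⁺) (c := hC.conj A⁻) (by
      ext x
      have := congrArg (fun X : H →L[ℂ] H => C (X (C x))) (CFC.posPart_sub_negPart A hA)
      simp only [sub_apply, map_sub] at this
      rw [h, hC.involutive] at this
      simpa using this.symm) (by
      ext x
      have := congrArg (fun X : H →L[ℂ] H => C (X (C x))) (CFC.posPart_mul_negPart A)
      simp only [zero_apply, map_zero] at this
      change C (A⁺ (C (C (A⁻ (C x))))) = 0
      rwa [hC.involutive])
      (hC.conj_nonneg (CFC.posPart_nonneg A)) (hC.conj_nonneg (CFC.negPart_nonneg A))).1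
  intro x
  have := congrArg (fun X : H →L[ℂ] H => X (C x)) key
  simp only [hC.conj_apply, hC.involutive] at this
  exact this.symm

/-- The spectral projection of a self-adjoint operator for the half-line `(-∞, 0]`. -/
lemma exists_spectralProjection (hC : IsConjugation C) {A : H →L[ℂ] H} (hA : IsSelfAdjoint A)
    (hr : IsReal C A) :
    ∃ F : H →L[ℂ] H, IsSelfAdjoint F ∧ F * F = F ∧ IsReal C F ∧
      (∀ X, IsSelfAdjoint X → Commute X A → Commute X F) ∧ F * A⁺ = 0 ∧ F * A⁻ = A⁻ := by
  let N : Submodule ℂ H := LinearMap.ker (A⁺ : H →L[ℂ] H).toLinearMap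
  have hNc : IsClosed (N : Set H) := (A⁺ : H →L[ℂ] H).isClosed_ker
  have : CompleteSpace N := hNc.completeSpace_coe
  have hsap : IsSelfAdjoint (A⁺ : H →L[ℂ] H) := (CFC.posPart_nonneg A).isSelfAdjoint
  let F : H →L[ℂ] H := N.starProjection
  have hF : IsSelfAdjoint F := isSelfAdjoint_starProjection N
  have hFF : F * F = F := N.isIdempotentElem_starProjection
  have hpF : A⁺ * F = 0 := by
    ext v
    exact LinearMap.mem_ker.1 (Submodule.starProjection_apply_mem N v)
  have hFn : F * A⁻ = A⁻ := by
    ext v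
    refine Submodule.starProjection_eq_self_iff.2 (LinearMap.mem_ker.2 ?_)
    exact congrArg (fun X : H →L[ℂ] H => X v) (CFC.posPart_mul_negPart A)
  have hFp : F * A⁺ = 0 := by
    have := congrArg star hpF
    simpa [hF.star_eq, hsap.star_eq] using this
  have hCN : ∀ v ∈ N, C v ∈ N := by
    intro v hv
    rw [LinearMap.mem_ker] at hv ⊢
    change A⁺ (C v) = 0
    rw [← hr.posPart hC hA v]
    rw [show A⁺ v = 0 from hv, map_zero]
  have hFr : IsReal C F := isReal_starProjection hC N hCN
  refine ⟨F, hF, hFF, hFr, ?_, hFp, hFn⟩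
  · intro X hX hXA
    refine commute_starProjection hX N ?_
    intro v hv
    have hc : Commute X A⁺ := by
      rw [CFC.posPart_def]
      exact (hXA.symm.cfcₙ_real _).symm
    refine LinearMap.mem_ker.2 ?_
    have := congrArg (fun Y : H →L[ℂ] H => Y v) hc.eq
    change X (A⁺ v) = A⁺ (X v) at this
    change A⁺ (X v) = 0
    rw [← this, show A⁺ v = 0 from hv, map_zero]

/-- The sign of a self-adjoint operator. -/
lemma exists_symmetry (hC : IsConjugation C) {A : H →L[ℂ] H} (hA : IsSelfAdjoint A)
    (hr : IsReal C A) :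
    ∃ S : H →L[ℂ] H, IsSelfAdjoint S ∧ S * S = 1 ∧ IsReal C S ∧
      (∀ X, IsSelfAdjoint X → Commute X A → Commute X S) ∧
      ∀ r, ‖A‖ ≤ r → ‖A - (r / 2) • S‖ ≤ r / 2 := by
  obtain ⟨F, hF, hFF, hFr, hcomm, hFp, hFn⟩ := exists_spectralProjection hC hA hr
  -- The reflection equal to `-1` on `ker A⁺` and `1` on its complement, so that `S |A| = A`.
  obtain ⟨S, hS⟩ : ∃ S, S = 1 - (F + F) := ⟨_, rfl⟩
  have hSS : S * S = 1 := by
    simp only [hS, mul_sub, sub_mul, mul_one, one_mul, mul_add, add_mul, hFF]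
    abel
  have hSsa : IsSelfAdjoint S := hS ▸ (IsSelfAdjoint.one _).sub (hF.add hF)
  refine ⟨S, hSsa, hSS, hS ▸ isReal_one.sub (hFr.add hFr), ?_, ?_⟩
  · intro X hX hXA
    have := hcomm X hX hXA
    exact hS ▸ (Commute.one_right X).sub_right (this.add_right this)
  · intro r hAr
    have hSA : S * (A⁺ + A⁻) = A := by
      conv_rhs => rw [← CFC.posPart_sub_negPart A hA]
      simp only [hS, mul_add, sub_mul, one_mul, add_mul, hFp, hFn]
      abel
    have hSn : ‖S‖ ≤ 1 := by
      refine opNorm_le_bound _ zero_le_one fun v => ?_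
      have : ⟪S v, S v⟫_ℂ = ⟪v, v⟫_ℂ := by
        rw [← adjoint_inner_left, ← star_eq_adjoint, hSsa.star_eq]
        change ⟪(S * S) v, v⟫_ℂ = _
        rw [hSS]; rfl
      rw [one_mul, @norm_eq_sqrt_re_inner ℂ, this, ← @norm_eq_sqrt_re_inner ℂ]
    -- As `|A|` has spectrum in `[0, r]`, subtracting the midpoint `r / 2` leaves norm at most `r /
    -- 2`.
    have e : A - (r / 2) • S = S * (CFC.abs A - algebraMap ℝ _ (r / 2)) := by
      rw [mul_sub, ← CFC.posPart_add_negPart A hA, hSA, Algebra.algebraMap_eq_smul_one,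
        mul_smul_comm, mul_one]
    have hr0 : 0 ≤ r := (norm_nonneg A).trans hAr
    have hn : ‖CFC.abs A - algebraMap ℝ (H →L[ℂ] H) (r / 2)‖ ≤ r / 2 := by
      rw [CFC.abs_eq_cfc_norm A hA, ← cfc_const (r / 2) A hA, ← cfc_sub ..]
      refine norm_cfc_le (by positivity) fun x hx => ?_
      have : ‖x‖ ≤ r := by
        cases subsingleton_or_nontrivial H
        · have : Subsingleton (H →L[ℂ] H) := inferInstance
          rw [spectrum.of_subsingleton] at hx
          exact hx.elim
        · exact (spectrum.norm_le_norm_of_mem hx).trans hAr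
      rw [Real.norm_eq_abs, abs_le]
      constructor <;> linarith [norm_nonneg x]
    rw [e]
    calc _ ≤ ‖S‖ * _ := norm_mul_le _ _
      _ ≤ 1 * (r / 2) := mul_le_mul hSn hn (norm_nonneg _) zero_le_one
      _ = r / 2 := one_mul _

/-- A real self-adjoint operator is a norm limit of real self-adjoint operators with finite
spectrum. -/
lemma exists_spectral_approx (hC : IsConjugation C) {A : H →L[ℂ] H} (hA : IsSelfAdjoint A)
    (hr : IsReal C A) (n : ℕ) :
    ∃ (ι : Type) (_ : Fintype ι) (E : ι → H →L[ℂ] H) (t : ι → ℝ),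
      CompleteOrthogonalIdempotents E ∧ (∀ k, IsSelfAdjoint (E k)) ∧ (∀ k, IsReal C (E k)) ∧
      (∀ k, Commute (E k) A) ∧ ‖A - ∑ k, t k • E k‖ ≤ ‖A‖ / 2 ^ n := by
  induction n with
  | zero =>
    refine ⟨Unit, inferInstance, fun _ => 1, fun _ => 0, ⟨⟨fun _ => IsIdempotentElem.one, ?_⟩, ?_⟩,
      fun _ => IsSelfAdjoint.one _, fun _ => isReal_one, fun _ => Commute.one_left _, ?_⟩
    · intro i j hij
      exact (hij (Subsingleton.elim i j)).elim
    · simp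
    · simp
  | succ n ih =>
    obtain ⟨ι, _, E, t, hE, hEsa, hEr, hEA, hn⟩ := ih
    set A₁ := A - ∑ k, t k • E k with hA₁
    have hEE : ∀ k l, Commute (E k) (E l) := by
      intro k l
      rcases eq_or_ne k l with rfl | hkl
      · exact Commute.refl _
      · exact (hE.ortho hkl).trans (hE.ortho hkl.symm).symm
    have hA₁sa : IsSelfAdjoint A₁ := by
      refine hA.sub ?_
      rw [isSelfAdjoint_iff, star_sum]
      exact Finset.sum_congr rfl fun k _ => by rw [star_smul, (hEsa k).star_eq, star_trivial]
    have hA₁r : IsReal C A₁ := hr.sub (IsReal.sum fun k _ => (hEr k).smul _)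
    have hEA₁ : ∀ k, Commute (E k) A₁ := fun k =>
      (hEA k).sub_right (Commute.sum_right _ _ _ fun l _ => (hEE k l).smul_right _)
    -- Subtracting a multiple of the sign of the remainder `A₁` halves the error bound.
    obtain ⟨S, hSsa, hSS, hSr, hSc, hSn⟩ := exists_symmetry hC hA₁sa hA₁r
    have hES : ∀ k, Commute (E k) S := fun k => hSc _ (hEsa k) (hEA₁ k)
    have hAS : Commute S A := (hSc A hA ((Commute.refl A).sub_right
      (Commute.sum_right _ _ _ fun l _ => (hEA l).symm.smul_right _))).symm
    obtain ⟨hG, hGsum⟩ := hE.halfSum hSS hES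
    have hGsa : ∀ b, IsSelfAdjoint (halfSum S b) := by
      intro b
      rw [isSelfAdjoint_iff]
      cases b <;> simp [halfSum, hSsa.star_eq]
    have hGE : ∀ b k, Commute (halfSum S b) (E k) := fun b k => (hES k).symm.halfSum_left b
    refine ⟨ι × Bool, inferInstance, fun p => E p.1 * halfSum S p.2,
      fun p => t p.1 + cond p.2 (‖A‖ / 2 ^ n / 2) (-(‖A‖ / 2 ^ n / 2)), hG, ?_, ?_, ?_, ?_⟩
    · rintro ⟨k, b⟩
      exact ((hEsa k).commute_iff (hGsa b)).1 (hGE b k).symm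
    · rintro ⟨k, b⟩
      exact (hEr k).mul ((isReal_one.add (by cases b; exacts [hSr.neg, hSr])).smul _)
    · rintro ⟨k, b⟩
      exact (hEA k).mul_left (hAS.halfSum_left b)
    · rw [hGsum, ← sub_sub, ← hA₁, pow_succ, ← div_div]
      exact hSn _ hn

end Spectral

/-! ### Creating simple eigenvectors by a small compact perturbation -/

section SimpleEigenvectors

open ContinuousLinearMap

lemma _root_.IsSelfAdjoint.inner_clm_left [CompleteSpace H] {A : H →L[ℂ] H} (hA : IsSelfAdjoint A)
    (x y : H) : ⟪A x, y⟫_ℂ = ⟪x, A y⟫_ℂ := by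
  rw [← adjoint_inner_right, ← star_eq_adjoint, hA.star_eq]

/-- Unit eigenvectors for distinct eigenvalues are orthogonal, hence at distance `√2`, and
separability allows only countably many. -/
lemma countable_eigenvalues [CompleteSpace H] [TopologicalSpace.SeparableSpace H] {A : H →L[ℂ] H}
    (hA : IsSelfAdjoint A) : {t : ℝ | ∃ v ≠ 0, A v = t • v}.Countable := by
  have hex : ∀ t ∈ {t : ℝ | ∃ v ≠ 0, A v = t • v}, ∃ v, ‖v‖ = 1 ∧ A v = t • v := by
    rintro t ⟨v, hv, hAv⟩
    refine ⟨(‖v‖⁻¹ : ℝ) • v, ?_, ?_⟩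
    · rw [norm_smul, norm_inv, norm_norm, inv_mul_cancel₀ (norm_ne_zero_iff.2 hv)]
    · rw [map_smul_of_tower, hAv, smul_comm]
  choose! v hv1 hv using hex
  refine Set.PairwiseDisjoint.countable_of_isOpen (s := fun t => Metric.ball (v t) (1 / 2)) ?_
    (fun t _ => Metric.isOpen_ball) (fun t _ => ⟨v t, Metric.mem_ball_self (by norm_num)⟩)
  intro t ht s hs hts
  refine Metric.ball_disjoint_ball ?_
  have h0 : ⟪v t, v s⟫_ℂ = 0 := by
    have := hA.inner_clm_left (v t) (v s)
    rw [hv t ht, hv s hs, ← Complex.coe_smul, ← Complex.coe_smul, inner_smul_left,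
      inner_smul_right, Complex.conj_ofReal, ← sub_eq_zero, ← sub_mul] at this
    refine (mul_eq_zero.1 this).resolve_left ?_
    rw [← Complex.ofReal_sub]
    exact Complex.ofReal_ne_zero.2 (sub_ne_zero.2 hts)
  have h2 := @norm_sub_sq ℂ _ _ _ _ (v t) (v s)
  rw [h0, hv1 t ht, hv1 s hs] at h2
  simp only [map_zero] at h2
  rw [dist_eq_norm]
  nlinarith [norm_nonneg (v t - v s)]

/-- Move along `t + a f` with distinct positive slopes `f k`: each collision or hit of `s` excludes
only countably many `a`. -/
lemma exists_injective_near {ι : Type*} [Fintype ι] (t : ι → ℝ) {s : Set ℝ} (hs : s.Countable)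
    {δ : ℝ} (hδ : 0 < δ) :
    ∃ t' : ι → ℝ, Function.Injective t' ∧ (∀ k, |t' k - t k| < δ) ∧ ∀ k, t' k ∉ s := by
  classical
  let f : ι → ℝ := fun k => (Fintype.equivFin ι k : ℕ) + 1
  have hf0 : ∀ k, 0 < f k := fun k => by positivity
  have hfi : Function.Injective f := fun k l h => by
    have : ((Fintype.equivFin ι k : ℕ) : ℝ) = (Fintype.equivFin ι l : ℕ) := by linarith
    exact (Fintype.equivFin ι).injective (Fin.ext (by exact_mod_cast this))
  obtain ⟨M, hM⟩ : ∃ M : ℝ, ∀ k, f k ≤ M :=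
    ⟨∑ k, f k, fun k => Finset.single_le_sum (fun i _ => (hf0 i).le) (Finset.mem_univ k)⟩
  let bad : Set ℝ := (⋃ k, (fun a => (a - t k) / f k) '' s) ∪
    ⋃ k, ⋃ l, {(t l - t k) / (f k - f l)}
  have hbad : bad.Countable := by
    refine (Set.countable_iUnion fun k => hs.image _).union ?_
    exact Set.countable_iUnion fun k => Set.countable_iUnion fun l => Set.countable_singleton _
  obtain ⟨a, ha, ha'⟩ := (hbad.dense_compl ℝ).exists_mem_open
    (isOpen_Ioo (a := 0) (b := δ / (|M| + 1))) (Set.nonempty_Ioo.2 (by positivity))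
  refine ⟨fun k => t k + a * f k, ?_, ?_, ?_⟩
  · intro k l hkl
    by_contra hne
    refine ha (Or.inr (Set.mem_iUnion.2 ⟨k, Set.mem_iUnion.2 ⟨l, ?_⟩⟩))
    have h : f k - f l ≠ 0 := sub_ne_zero.2 fun h => hne (hfi h)
    simp only at hkl
    rw [Set.mem_singleton_iff, eq_div_iff h]
    linarith
  · intro k
    have h1 : a * f k ≤ a * |M| := by
      gcongr
      exacts [ha'.1.le, (hM k).trans (le_abs_self M)]
    have h2 : a * (|M| + 1) < δ := by
      have := ha'.2
      rwa [lt_div_iff₀ (by positivity)] at this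
    rw [add_sub_cancel_left, abs_of_pos (mul_pos ha'.1 (hf0 k))]
    linarith [ha'.1]
  · intro k hk
    refine ha (Or.inl (Set.mem_iUnion.2 ⟨k, _, hk, ?_⟩))
    simp only
    rw [add_sub_cancel_left, mul_div_cancel_right₀ _ (hf0 k).ne']

lemma isCompactOperator_starProjection (N : Submodule ℂ H) [FiniteDimensional ℂ N] :
    IsCompactOperator N.starProjection := by
  have : ProperSpace N := FiniteDimensional.proper ℂ N
  have h := isCompactOperator_of_locallyCompactSpace_dom N.orthogonalProjectionOnto
  exact h.clm_comp N.subtypeL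

variable [CompleteSpace H] {C : H →ₗ⋆[ℂ] H}

/-- A real vector is a sum of simple eigenvectors of a small compact perturbation of a real
self-adjoint operator. -/
lemma exists_simple_eigenvectors [TopologicalSpace.SeparableSpace H] (hC : IsConjugation C)
    {A : H →L[ℂ] H} (hA : IsSelfAdjoint A) (hr : IsReal C A) (x : H) (hx : C x = x)
    {δ : ℝ} (hδ : 0 < δ) :
    ∃ A' : H →L[ℂ] H, IsSelfAdjoint A' ∧ IsReal C A' ∧ IsCompactOperator (A' - A) ∧
      ‖A' - A‖ ≤ δ ∧ ∃ (ι : Type) (_ : Fintype ι) (y : ι → H) (t : ι → ℝ), ∑ k, y k = x ∧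
        (∀ k l, k ≠ l → ⟪y k, y l⟫_ℂ = 0) ∧ (∀ k, A' (y k) = t k • y k) ∧
        ∀ k v, A' v = t k • v → ∃ c : ℂ, v = c • y k := by
  obtain ⟨n, hn⟩ : ∃ n : ℕ, ‖A‖ / 2 ^ n ≤ δ / 4 := by
    obtain ⟨n, hn⟩ := exists_pow_lt_of_lt_one (show 0 < δ / 4 / (‖A‖ + 1) by positivity)
      (show (1 / 2 : ℝ) < 1 by norm_num)
    refine ⟨n, ?_⟩
    rw [lt_div_iff₀ (by positivity)] at hn
    rw [div_eq_mul_inv, ← inv_pow, ← one_div]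
    have : 0 ≤ (1 / 2 : ℝ) ^ n := by positivity
    nlinarith
  obtain ⟨ι, _, E, t, hE, hEsa, hEr, -, hEn⟩ := exists_spectral_approx hC hA hr n
  classical
  have hEE : ∀ k l v, E k (E l v) = if k = l then E k v else 0 := by
    intro k l v
    change (E k * E l) v = _
    split_ifs with h
    · rw [← h, (hE.idem k).eq]
    · rw [hE.ortho h]; rfl
  let y : ι → H := fun k => E k x
  -- On `M` each `E k` has range in the line of `y k`, so a combination of the `E k` with distinct
  -- coefficients has simple spectrum there.
  let M : Submodule ℂ H := Submodule.span ℂ (Set.range y)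
  have : FiniteDimensional ℂ M := FiniteDimensional.span_of_finite ℂ (Set.finite_range y)
  have hyM : ∀ k, y k ∈ M := fun k => Submodule.subset_span ⟨k, rfl⟩
  have hEM : ∀ k, ∀ v ∈ M, ∃ c : ℂ, E k v = c • y k := by
    intro k v hv
    induction hv using Submodule.span_induction with
    | mem v hv =>
      obtain ⟨l, rfl⟩ := hv
      by_cases h : k = l
      · exact ⟨1, by simp [y, hEE, h]⟩
      · exact ⟨0, by simp [y, hEE, h]⟩
    | zero => exact ⟨0, by simp⟩
    | add u v _ _ hu hv =>
      obtain ⟨a, ha⟩ := hu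
      obtain ⟨b, hb⟩ := hv
      exact ⟨a + b, by rw [map_add, ha, hb, add_smul]⟩
    | smul a v _ hv =>
      obtain ⟨b, hb⟩ := hv
      exact ⟨a * b, by rw [map_smul, hb, mul_smul]⟩
  have hCM : ∀ v ∈ M, C v ∈ M := by
    intro v hv
    induction hv using Submodule.span_induction with
    | mem v hv =>
      obtain ⟨l, rfl⟩ := hv
      have : C (y l) = y l := by rw [hEr l x, hx]
      rw [this]
      exact hyM l
    | zero => simp
    | add u v _ _ hu hv => rw [map_add]; exact M.add_mem hu hv
    | smul a v _ hv => rw [map_smulₛₗ]; exact M.smul_mem _ hv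
  obtain ⟨P, hP⟩ : ∃ P, P = M.starProjection := ⟨_, rfl⟩
  have hPsa : IsSelfAdjoint P := hP ▸ isSelfAdjoint_starProjection M
  have hPP : P * P = P := hP ▸ M.isIdempotentElem_starProjection
  have hPr : IsReal C P := hP ▸ isReal_starProjection hC M hCM
  have hPc : IsCompactOperator P := hP ▸ isCompactOperator_starProjection M
  have hPn : ‖P‖ ≤ 1 := hP ▸ M.starProjection_norm_le
  have hPn' : ‖1 - P‖ ≤ 1 := by
    rw [hP, ← Submodule.starProjection_orthogonal']
    exact Mᗮ.starProjection_norm_le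
  have hPM : ∀ v ∈ M, P v = v := fun v hv => hP ▸ Submodule.starProjection_eq_self_iff.2 hv
  have hPmem : ∀ v, P v ∈ M := fun v => hP ▸ Submodule.starProjection_apply_mem M v
  have h1Psa : IsSelfAdjoint (1 - P) := (IsSelfAdjoint.one _).sub hPsa
  have hA0 : IsSelfAdjoint ((1 - P) * A * (1 - P)) := by
    simpa [h1Psa.star_eq] using hA.conjugate (1 - P)
  -- Avoiding the eigenvalues of the compression to `Mᗮ` forces every eigenvector of `A'` for `s k`
  -- into `M`.
  obtain ⟨s, hsi, hst, hsA⟩ := exists_injective_near t (countable_eigenvalues hA0)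
    (show 0 < δ / 4 / ((∑ k, ‖E k‖) + 1) by positivity)
  obtain ⟨Q, hQ⟩ : ∃ Q, Q = ∑ k, s k • E k := ⟨_, rfl⟩
  have hQv : ∀ v, Q v = ∑ k, s k • E k v := fun v => by simp [hQ]
  have hQsa : IsSelfAdjoint Q := by
    rw [isSelfAdjoint_iff, hQ, star_sum]
    exact Finset.sum_congr rfl fun k _ => by rw [star_smul, (hEsa k).star_eq, star_trivial]
  have hQr : IsReal C Q := hQ ▸ IsReal.sum fun k _ => (hEr k).smul _
  have hQM : ∀ v ∈ M, Q v ∈ M := by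
    intro v hv
    rw [hQv]
    refine M.sum_mem fun k _ => ?_
    obtain ⟨c, hc⟩ := hEM k v hv
    rw [hc, ← Complex.coe_smul]
    exact M.smul_mem _ (M.smul_mem _ (hyM k))
  have hQP : Q * P = P * Q := (hP ▸ commute_starProjection hQsa M hQM : Commute Q P).eq
  have hAQ : ‖A - Q‖ ≤ δ / 2 := by
    have h1 : ‖(∑ k, t k • E k) - Q‖ ≤ δ / 4 := by
      rw [hQ, ← Finset.sum_sub_distrib]
      calc ‖∑ k, (t k • E k - s k • E k)‖ ≤ ∑ k, ‖t k • E k - s k • E k‖ := norm_sum_le _ _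
        _ ≤ ∑ k, δ / 4 / ((∑ k, ‖E k‖) + 1) * ‖E k‖ := by
          refine Finset.sum_le_sum fun k _ => ?_
          rw [← sub_smul, norm_smul, Real.norm_eq_abs, abs_sub_comm]
          exact mul_le_mul_of_nonneg_right (hst k).le (norm_nonneg _)
        _ = δ / 4 * ((∑ k, ‖E k‖) / ((∑ k, ‖E k‖) + 1)) := by rw [← Finset.mul_sum]; ring
        _ ≤ δ / 4 * 1 := by
          gcongr
          refine div_le_one_of_le₀ (by linarith) (by positivity)
        _ = δ / 4 := mul_one _
    calc ‖A - Q‖ = ‖(A - ∑ k, t k • E k) + ((∑ k, t k • E k) - Q)‖ := by congr 1; abel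
      _ ≤ ‖A - ∑ k, t k • E k‖ + ‖(∑ k, t k • E k) - Q‖ := norm_add_le _ _
      _ ≤ δ / 2 := by linarith
  obtain ⟨A', hA'⟩ : ∃ A', A' = (1 - P) * A * (1 - P) + Q * P := ⟨_, rfl⟩
  have hA'y : ∀ v ∈ M, A' v = Q v := by
    intro v hv
    rw [hA']
    change ((1 - P) * A) (v - P v) + Q (P v) = Q v
    rw [hPM v hv, sub_self, map_zero, zero_add]
  have hsum : ∀ v, ∑ k, E k v = v := fun v => by
    have := congrArg (fun X : H →L[ℂ] H => X v) hE.complete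
    simpa using this
  refine ⟨A', ?_, ?_, ?_, ?_, ι, inferInstance, y, s, hsum x, ?_, ?_, ?_⟩
  · rw [hA']
    exact hA0.add ((hQsa.commute_iff hPsa).1 hQP)
  · rw [hA']
    exact (((isReal_one.sub hPr).mul hr).mul (isReal_one.sub hPr)).add (hQr.mul hPr)
  · have e : A' - A = (Q - A) * P - P * (A * (1 - P)) := by
      rw [hA']; noncomm_ring
    rw [e]
    exact (hPc.clm_comp (Q - A)).sub (hPc.comp_clm (A * (1 - P)))
  -- `Q` commutes with `P`, so only `Q - A` appears, in two terms of norm at most `δ / 2` each.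
  · have e : A' - A = (Q - A) * P + P * (Q - A) * (1 - P) := by
      rw [hA', mul_sub P Q A, ← hQP, sub_mul (Q * P)]
      have : Q * P * (1 - P) = 0 := by rw [mul_assoc, mul_sub, mul_one, hPP, sub_self, mul_zero]
      rw [this]
      noncomm_ring
    have hn' : ‖Q - A‖ ≤ δ / 2 := by rwa [norm_sub_rev]
    rw [e]
    calc _ ≤ ‖(Q - A) * P‖ + ‖P * (Q - A) * (1 - P)‖ := norm_add_le _ _
      _ ≤ ‖Q - A‖ * ‖P‖ + ‖P‖ * ‖Q - A‖ * ‖1 - P‖ := by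
        refine add_le_add (norm_mul_le _ _) ((norm_mul_le _ _).trans ?_)
        gcongr
        exact norm_mul_le _ _
      _ ≤ (δ / 2) * 1 + 1 * (δ / 2) * 1 := by gcongr
      _ = δ := by ring
  · intro k l hkl
    rw [(hEsa k).inner_clm_left, hEE, if_neg hkl, inner_zero_right]
  · intro k
    rw [hA'y _ (hyM k), hQv]
    simp [y, hEE]
  · intro k v hv
    have hu : (1 - P) v = 0 := by
      by_contra hne
      refine hsA k ⟨(1 - P) v, hne, ?_⟩
      have e : (1 - P) * A * (1 - P) * (1 - P) = (1 - P) * A' := by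
        have h1 : (1 - P) * (1 - P) = 1 - P := by
          rw [mul_sub, mul_one, sub_mul, one_mul, hPP, sub_self, sub_zero]
        have h2 : (1 - P) * (Q * P) = 0 := by
          rw [hQP, ← mul_assoc, sub_mul, one_mul, hPP, sub_self, zero_mul]
        rw [hA', mul_add, h2, add_zero, mul_assoc ((1 - P) * A), h1, ← mul_assoc, ← mul_assoc, h1]
      change ((1 - P) * A * (1 - P) * (1 - P)) v = _
      rw [e]
      change (1 - P) (A' v) = _
      rw [hv, map_smul_of_tower]
    have hvP : P v = v := (sub_eq_zero.1 hu).symm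
    have hvM : v ∈ M := hvP ▸ hPmem v
    rw [hA'y v hvM, hQv] at hv
    have hl : ∀ l, l ≠ k → E l v = 0 := by
      intro l hl
      have := congrArg (E l) hv
      simp only [map_sum, map_smul_of_tower, hEE] at this
      simp only [smul_ite, smul_zero, Finset.sum_ite_eq, Finset.mem_univ, if_true] at this
      rw [← sub_eq_zero, ← sub_smul] at this
      exact (smul_eq_zero.1 this).resolve_left (sub_ne_zero.2 fun h => hl (hsi h))
    obtain ⟨c, hc⟩ := hEM k v hvM
    refine ⟨c, ?_⟩
    rw [← hc]
    conv_lhs => rw [← hsum v]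
    exact Finset.sum_eq_single k (fun l _ h => hl l h) (by simp)

end SimpleEigenvectors

/-! ### Density: forcing a real vector to be an eigenvector -/

section SmallPerturbation

/-- The defect of `x` being an eigenvector of `D`, tested against `y`. -/
noncomputable def eigenDefect (D : H →L[ℂ] H) (x y : H) : ℂ :=
  ⟪D x, y⟫_ℂ * ⟪x, x⟫_ℂ - ⟪D x, x⟫_ℂ * ⟪x, y⟫_ℂ

lemma eigenDefect_eq_zero {D : H →L[ℂ] H} {x : H} {c : ℂ} (h : D x = c • x) (y : H) :
    eigenDefect D x y = 0 := by
  rw [eigenDefect, h, inner_smul_left, inner_smul_left]; ring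

variable [CompleteSpace H] {C : H →ₗ⋆[ℂ] H}

section Perturbation

open ContinuousLinearMap

/-- `X` is symmetric with respect to `C`: `C X C = X*`. -/
def IsSymmetricFor (C : H →ₗ⋆[ℂ] H) (X : H →L[ℂ] H) : Prop :=
  ∀ x, C (X (C x)) = adjoint X x

lemma IsSymmetricFor.add {X Y : H →L[ℂ] H} (hX : IsSymmetricFor C X) (hY : IsSymmetricFor C Y) :
    IsSymmetricFor C (X + Y) :=
  fun x => by simp [hX x, hY x]

lemma isSymmetricFor_add_I_smul (hC : IsConjugation C) {A B : H →L[ℂ] H} (hA : IsSelfAdjoint A)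
    (hAr : IsReal C A) (hB : IsSelfAdjoint B) (hBr : IsReal C B) :
    IsSymmetricFor C (A + Complex.I • B) := by
  intro x
  rw [← star_eq_adjoint, star_add, star_smul, hA.star_eq, hB.star_eq]
  simp [hAr _, hBr _, hC.involutive]

/-- The Cartesian decomposition of a `C`-symmetric operator. -/
lemma IsSymmetricFor.exists_cartesian (hC : IsConjugation C) {T : H →L[ℂ] H}
    (hT : IsSymmetricFor C T) :
    ∃ A B : H →L[ℂ] H, IsSelfAdjoint A ∧ IsReal C A ∧ IsSelfAdjoint B ∧ IsReal C B ∧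
      T = A + Complex.I • B := by
  have h1 : ∀ x, C (T x) = star T (C x) := fun x => by
    rw [star_eq_adjoint, ← hT, hC.involutive]
  have h2 : ∀ x, C (star T x) = T (C x) := fun x => by
    rw [star_eq_adjoint, ← hT, hC.involutive]
  refine ⟨(1 / 2 : ℂ) • (T + star T), (-Complex.I / 2) • (T - star T), ?_, ?_, ?_, ?_, ?_⟩
  · rw [isSelfAdjoint_iff, star_smul, star_add, star_star, add_comm]
    simp
  · intro x
    simp [h1, h2, add_comm, map_ofNat]
  · rw [isSelfAdjoint_iff, star_smul, star_sub, star_star, ← neg_sub T, smul_neg, ← neg_smul]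
    congr 1
    simp [neg_div]
  · intro x
    simp only [smul_apply, sub_apply, map_smulₛₗ, map_sub, h1, h2]
    rw [← neg_sub (T (C x)), smul_neg, ← neg_smul]
    congr 1
    simp [neg_div, map_ofNat]
  · rw [smul_smul]
    have : Complex.I * (-Complex.I / 2) = 1 / 2 := by
      rw [mul_div_assoc', mul_neg, Complex.I_mul_I, neg_neg]
    rw [this]
    module

/-- Taking adjoints, `D` also commutes with `A - iB`. -/
lemma commute_cartesian {A B D : H →L[ℂ] H} (hA : IsSelfAdjoint A) (hB : IsSelfAdjoint B)
    (hD : IsSelfAdjoint D) (h : Commute D (A + Complex.I • B)) : Commute D A ∧ Commute D B := by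
  have h' : Commute D (A - Complex.I • B) := by
    have := h.star_star
    rw [hD.star_eq, star_add, star_smul, hA.star_eq, hB.star_eq] at this
    simpa [sub_eq_add_neg] using this
  constructor
  · have e : A = (1 / 2 : ℂ) • ((A + Complex.I • B) + (A - Complex.I • B)) := by module
    rw [e]
    exact (h.add_right h').smul_right _
  · have e : B = (-Complex.I / 2) • ((A + Complex.I • B) - (A - Complex.I • B)) := by
      have : (A + Complex.I • B) - (A - Complex.I • B) = (2 * Complex.I) • B := by module
      rw [this, smul_smul]
      have : -Complex.I / 2 * (2 * Complex.I) = 1 := by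
        rw [div_mul_eq_mul_div, mul_left_comm, neg_mul, Complex.I_mul_I]; norm_num
      rw [this, one_smul]
    rw [e]
    exact (h.sub_right h').smul_right _

/-- After a small compact perturbation, a given real vector is an eigenvector of every
self-adjoint operator commuting with the perturbed operator. -/
lemma exists_compact_perturbation_eigenvector [TopologicalSpace.SeparableSpace H]
    (hC : IsConjugation C) {T : H →L[ℂ] H} (hT : IsSymmetricFor C T) (x : H) (hx : C x = x)
    {δ : ℝ} (hδ : 0 < δ) :
    ∃ K : H →L[ℂ] H, IsCompactOperator K ∧ IsSymmetricFor C K ∧ ‖K‖ < δ ∧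
      ∀ D : H →L[ℂ] H, IsSelfAdjoint D → Commute D (T + K) → ∃ c : ℂ, D x = c • x := by
  obtain ⟨A, B, hA, hAr, hB, hBr, rfl⟩ := hT.exists_cartesian hC
  obtain ⟨A', hA', hA'r, hKc, hKn, ι, _, y, t, hyx, hyo, hyt, hsimple⟩ :=
    exists_simple_eigenvectors hC hA hAr x hx (show 0 < δ / 2 by positivity)
  set R : H →L[ℂ] H := InnerProductSpace.rankOne ℂ x x with hR
  have hRsa : IsSelfAdjoint R := by
    rw [isSelfAdjoint_iff, star_eq_adjoint, hR, InnerProductSpace.adjoint_rankOne]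
  have hRr : IsReal C R := by
    intro v
    simp only [hR, InnerProductSpace.rankOne_apply, map_smulₛₗ, hx]
    rw [inner_conj_symm, ← hC.inner_map_map, hx]
  have hRc : IsCompactOperator R := by
    have h : IsCompactOperator (innerSL ℂ x) :=
      isCompactOperator_of_locallyCompactSpace_dom (innerSL ℂ x)
    exact h.clm_comp (toSpanSingleton ℂ x)
  have hyx' : ∀ k, ⟪x, y k⟫_ℂ = (‖y k‖ ^ 2 : ℝ) := by
    intro k
    rw [← hyx, sum_inner, Finset.sum_eq_single k (fun l _ h => hyo l k h) (by simp)]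
    rw [inner_self_eq_norm_sq_to_K]
    simp
  have hRy : ∀ k l, ⟪y l, R (y k)⟫_ℂ = (‖y k‖ ^ 2 * ‖y l‖ ^ 2 : ℝ) := by
    intro k l
    simp only [hR, InnerProductSpace.rankOne_apply, inner_smul_right, hyx']
    rw [← inner_conj_symm, hyx']
    simp
  -- The values of `τ` at which `⟪y l, (B + τ • R) (y k)⟫` has zero real part. If `y k` or `y l`
  -- vanishes, the quotient is the default `0`, which is harmless since `τ > 0` is chosen.
  let bad : Set ℝ := ⋃ k, ⋃ l, {-(⟪y l, B (y k)⟫_ℂ).re / (‖y k‖ ^ 2 * ‖y l‖ ^ 2)}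
  have hbad : bad.Countable :=
    Set.countable_iUnion fun k => Set.countable_iUnion fun l => Set.countable_singleton _
  obtain ⟨τ, hτ, hτ'⟩ := (hbad.dense_compl ℝ).exists_mem_open
    (isOpen_Ioo (a := 0) (b := δ / 2 / (‖R‖ + 1))) (Set.nonempty_Ioo.2 (by positivity))
  have hτR : ‖τ • R‖ < δ / 2 := by
    have h := hτ'.2
    rw [lt_div_iff₀ (by positivity)] at h
    rw [norm_smul, Real.norm_of_nonneg hτ'.1.le]
    nlinarith [hτ'.1]
  have hτRsa : IsSelfAdjoint (τ • R) := by
    rw [isSelfAdjoint_iff, star_smul, star_trivial, hRsa.star_eq]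
  refine ⟨(A' - A) + Complex.I • (τ • R), hKc.add ((hRc.smul τ).smul Complex.I),
    isSymmetricFor_add_I_smul hC (hA'.sub hA) (hA'r.sub hAr) hτRsa (hRr.smul τ), ?_, ?_⟩
  · calc _ ≤ ‖A' - A‖ + ‖Complex.I • (τ • R)‖ := norm_add_le _ _
      _ < δ / 2 + δ / 2 := by
        rw [norm_smul Complex.I, Complex.norm_I, one_mul]
        exact add_lt_add_of_le_of_lt hKn hτR
      _ = δ := add_halves δ
  · intro D hD hcomm
    have e : A + Complex.I • B + (A' - A + Complex.I • (τ • R)) =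
        A' + Complex.I • (B + τ • R) := by
      rw [smul_add]; abel
    rw [e] at hcomm
    obtain ⟨hDA, hDB⟩ := commute_cartesian hA' (hB.add hτRsa) hD hcomm
    have hDy : ∀ k, ∃ c : ℂ, D (y k) = c • y k := by
      intro k
      refine hsimple k _ ?_
      have := congrArg (fun X : H →L[ℂ] H => X (y k)) hDA.eq
      change D (A' (y k)) = A' (D (y k)) at this
      rw [← this, hyt, map_smul_of_tower]
    choose d hd using hDy
    -- Comparing the nonzero matrix entry of `B + τ • R` on both sides of its commutation with `D`
    -- gives the equality.
    have hdd : ∀ k l, y k ≠ 0 → y l ≠ 0 → conj (d l) = d k := by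
      intro k l hk hl
      have hne : ⟪y l, (B + τ • R) (y k)⟫_ℂ ≠ 0 := by
        intro h0
        refine hτ (Set.mem_iUnion.2 ⟨k, Set.mem_iUnion.2 ⟨l, ?_⟩⟩)
        have hp : 0 < ‖y k‖ ^ 2 * ‖y l‖ ^ 2 := by
          have := norm_pos_iff.2 hk
          have := norm_pos_iff.2 hl
          positivity
        rw [add_apply, smul_apply, inner_add_right, ← Complex.coe_smul, inner_smul_right, hRy] at h0
        have h1 := congrArg Complex.re h0
        rw [Complex.add_re, ← Complex.ofReal_mul, Complex.ofReal_re, Complex.zero_re] at h1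
        rw [Set.mem_singleton_iff, eq_div_iff hp.ne']
        linarith
      have h1 := congrArg (fun X : H →L[ℂ] H => ⟪y l, X (y k)⟫_ℂ) hDB.eq
      change ⟪y l, D ((B + τ • R) (y k))⟫_ℂ = ⟪y l, (B + τ • R) (D (y k))⟫_ℂ at h1
      rw [← hD.inner_clm_left, hd, hd, map_smul, inner_smul_left, inner_smul_right] at h1
      exact mul_right_cancel₀ hne h1
    by_cases h : ∃ k, y k ≠ 0
    · obtain ⟨k, hk⟩ := h
      refine ⟨conj (d k), ?_⟩
      rw [← hyx, map_sum, Finset.smul_sum]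
      refine Finset.sum_congr rfl fun l _ => ?_
      by_cases hl : y l = 0
      · simp [hl]
      · rw [hd, hdd l k hl hk]
    · push Not at h
      exact ⟨0, by rw [← hyx]; simp [h]⟩

end Perturbation

/-! ### Openness: weak limits of commuting contractions -/

section WeakLimit

open ContinuousLinearMap Filter Topology

/-- Along an ultrafilter, contractions have a weak operator limit. -/
lemma exists_weak_limit {α : Type*} (U : Ultrafilter α) (D : α → H →L[ℂ] H)
    (hD : ∀ i, ‖D i‖ ≤ 1) :
    ∃ L : H →L[ℂ] H, ‖L‖ ≤ 1 ∧ ∀ x y, Tendsto (fun i => ⟪D i x, y⟫_ℂ) U (𝓝 ⟪L x, y⟫_ℂ) := by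
  have hb : ∀ i x y, ‖⟪D i x, y⟫_ℂ‖ ≤ ‖x‖ * ‖y‖ := fun i x y =>
    (norm_inner_le_norm _ _).trans (by
      gcongr
      simpa using (D i).le_of_opNorm_le (hD i) x)
  have hex : ∀ x y, ∃ a : ℂ, ‖a‖ ≤ ‖x‖ * ‖y‖ ∧ Tendsto (fun i => ⟪D i x, y⟫_ℂ) U (𝓝 a) := by
    intro x y
    obtain ⟨a, ha, hlim⟩ := (isCompact_closedBall (0 : ℂ) (‖x‖ * ‖y‖)).ultrafilter_le_nhds'
      (U.map fun i => ⟪D i x, y⟫_ℂ)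
      (Ultrafilter.mem_map.2 (Filter.univ_mem' fun i => by simpa using hb i x y))
    exact ⟨a, by simpa using ha, hlim⟩
  choose f hfn hf using hex
  let F : H →ₗ⋆[ℂ] H →ₗ[ℂ] ℂ := LinearMap.mk₂'ₛₗ (starRingEnd ℂ) (RingHom.id ℂ) f
    (fun x x' y => tendsto_nhds_unique (hf _ _) (by
      simpa [inner_add_left] using (hf x y).add (hf x' y)))
    (fun c x y => tendsto_nhds_unique (hf _ _) (by
      simpa [inner_smul_left, mul_comm] using (hf x y).const_mul (conj c)))
    (fun x y y' => tendsto_nhds_unique (hf _ _) (by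
      simpa [inner_add_right] using (hf x y).add (hf x y')))
    (fun c x y => tendsto_nhds_unique (hf _ _) (by
      simpa [inner_smul_right] using (hf x y).const_mul c))
  let L := InnerProductSpace.continuousLinearMapOfBilin (𝕜 := ℂ)
    (F.mkContinuous₂ 1 (fun x y => by rw [one_mul]; exact hfn x y))
  have hL : ∀ x y, ⟪L x, y⟫_ℂ = f x y := fun x y => by
    simp [L, F]
  refine ⟨L, ?_, fun x y => by rw [hL]; exact hf x y⟩
  refine opNorm_le_bound _ zero_le_one fun x => ?_
  rw [one_mul]
  by_cases h0 : ‖L x‖ = 0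
  · rw [h0]; exact norm_nonneg _
  · have h1 : ‖L x‖ * ‖L x‖ ≤ ‖x‖ * ‖L x‖ := by
      have := hfn x (L x)
      rw [← hL, inner_self_eq_norm_sq_to_K] at this
      simpa [sq] using this
    exact le_of_mul_le_mul_right h1 (lt_of_le_of_ne (norm_nonneg _) (Ne.symm h0))

/-- The operators whose self-adjoint commutant has small eigenvector defect at `x, y`
form an open set. -/
lemma isOpen_eigenDefect_lt (x y : H) (r : ℝ) :
    IsOpen {T : H →L[ℂ] H | ∀ D : H →L[ℂ] H, ‖D‖ ≤ 1 → IsSelfAdjoint D → Commute D T →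
      ‖eigenDefect D x y‖ < r} := by
  rw [← isClosed_compl_iff, ← isSeqClosed_iff_isClosed]
  intro T T₀ hT hlim
  simp only [Set.mem_compl_iff, Set.mem_ofPred_eq, not_forall, not_lt] at hT
  choose D hD1 hDsa hDT hDr using hT
  let U : Ultrafilter ℕ := hyperfilter ℕ
  have hU : (U : Filter ℕ) ≤ atTop := Nat.hyperfilter_le_atTop
  obtain ⟨L, hL1, hL⟩ := exists_weak_limit U D hD1
  have hT0 : Tendsto (fun n => ‖T n - T₀‖) U (𝓝 0) :=
    (tendsto_iff_norm_sub_tendsto_zero.1 hlim).mono_left hU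
  simp only [Set.mem_compl_iff, Set.mem_ofPred_eq, not_forall, not_lt]
  refine ⟨L, hL1, ?_, ?_, ?_⟩
  · rw [isSelfAdjoint_iff, star_eq_adjoint]
    refine ext fun u => ext_inner_right ℂ fun v => ?_
    rw [adjoint_inner_left]
    have h1 : Tendsto (fun n => ⟪u, D n v⟫_ℂ) U (𝓝 ⟪u, L v⟫_ℂ) := by
      have := (Complex.continuous_conj.tendsto _).comp (hL v u)
      simpa [Function.comp_def] using this
    refine tendsto_nhds_unique h1 ?_
    simpa only [(hDsa _).inner_clm_left] using hL u v
  · refine ext fun u => ext_inner_right ℂ fun v => ?_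
    change ⟪L (T₀ u), v⟫_ℂ = ⟪T₀ (L u), v⟫_ℂ
    rw [← adjoint_inner_right T₀]
    refine tendsto_nhds_unique (hL (T₀ u) v) ?_
    have h1 := hL u (adjoint T₀ v)
    -- The commutator of `D n` with `T₀` tends to zero weakly, since `D n` commutes with `T n` and
    -- `T n → T₀` in norm.
    have h2 : Tendsto (fun n => ⟪(T n - T₀) (D n u), v⟫_ℂ - ⟪D n ((T n - T₀) u), v⟫_ℂ) U (𝓝 0) := by
      have h3 : Tendsto (fun n => 2 * ‖T n - T₀‖ * (‖u‖ * ‖v‖)) U (𝓝 0) := by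
        simpa using (hT0.const_mul 2).mul_const (‖u‖ * ‖v‖)
      refine squeeze_zero_norm (fun n => ?_) h3
      have hDn : ∀ w, ‖D n w‖ ≤ ‖w‖ := fun w => by simpa using (D n).le_of_opNorm_le (hD1 n) w
      have a1 : ‖⟪(T n - T₀) (D n u), v⟫_ℂ‖ ≤ ‖T n - T₀‖ * ‖u‖ * ‖v‖ :=
        (norm_inner_le_norm _ _).trans (by
          gcongr
          exact ((T n - T₀).le_opNorm _).trans (by gcongr; exact hDn u))
      have a2 : ‖⟪D n ((T n - T₀) u), v⟫_ℂ‖ ≤ ‖T n - T₀‖ * ‖u‖ * ‖v‖ :=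
        (norm_inner_le_norm _ _).trans (by
          gcongr
          exact (hDn _).trans ((T n - T₀).le_opNorm _))
      calc _ ≤ _ := norm_sub_le _ _
        _ ≤ _ := add_le_add a1 a2
        _ = _ := by ring
    have h3 := h1.add h2
    rw [add_zero] at h3
    refine h3.congr fun n => ?_
    have hc := congrArg (fun X : H →L[ℂ] H => ⟪X u, v⟫_ℂ) (hDT n).eq
    change ⟪D n (T n u), v⟫_ℂ = ⟪T n (D n u), v⟫_ℂ at hc
    simp only [sub_apply, map_sub, inner_sub_left, adjoint_inner_right]
    rw [hc]; ring
  -- The defect depends on `D` only through two matrix coefficients, so it is continuous under weak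
  -- limits.
  · refine ge_of_tendsto' (f := fun n => ‖eigenDefect (D n) x y‖) (x := (U : Filter ℕ)) ?_ hDr
    exact (((hL x y).mul_const _).sub ((hL x x).mul_const _)).norm

end WeakLimit

end SmallPerturbation

/-! ### The Baire category argument -/

section Irreducible

/-- Every `v` is a complex combination of the real vectors `v + C v` and `i (v - C v)`. -/
lemma clm_ext_of_real {C : H →ₗ⋆[ℂ] H} (hC : IsConjugation C) {X Y : H →L[ℂ] H}
    (h : ∀ x, C x = x → X x = Y x) : X = Y := by
  ext v
  have h1 := h (v + C v) (by rw [map_add, hC.involutive, add_comm])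
  have h2 := h (Complex.I • (v - C v)) (by
    rw [map_smulₛₗ, map_sub, hC.involutive, Complex.conj_I, neg_smul, ← smul_neg, neg_sub])
  rw [map_smul, map_smul] at h2
  have h3 := smul_right_injective H Complex.I_ne_zero h2
  rw [map_add, map_add] at h1
  simp only [map_sub] at h3
  have h4 : (2 : ℂ) • X v = (2 : ℂ) • Y v := by
    calc (2 : ℂ) • X v = (X v + X (C v)) + (X v - X (C v)) := by module
      _ = (Y v + Y (C v)) + (Y v - Y (C v)) := by rw [h1, h3]
      _ = (2 : ℂ) • Y v := by module
  exact smul_right_injective H two_ne_zero h4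

lemma separableSpace_of_hilbertBasis {ι : Type*} [Countable ι] (e : HilbertBasis ι ℂ H) :
    TopologicalSpace.SeparableSpace H := by
  have h := ((Set.countable_range e).isSeparable.span (R := ℂ)).closure
  rw [← Submodule.topologicalClosure_coe, e.dense_span] at h
  exact TopologicalSpace.isSeparable_univ_iff.1 h

variable [CompleteSpace H] {C : H →ₗ⋆[ℂ] H}

lemma isClosed_isSymmetricFor (hC : IsConjugation C) :
    IsClosed {X : H →L[ℂ] H | IsSymmetricFor C X} := by
  have : {X : H →L[ℂ] H | IsSymmetricFor C X} =
      ⋂ x, {X : H →L[ℂ] H | C (X (C x)) = ContinuousLinearMap.adjoint X x} := by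
    ext X
    simp [IsSymmetricFor]
  rw [this]
  refine isClosed_iInter fun x => isClosed_eq ?_ ?_
  · exact hC.continuous.comp (by fun_prop)
  · exact (ContinuousLinearMap.apply ℂ H x).continuous.comp
      (ContinuousLinearMap.adjoint (𝕜 := ℂ) (E := H) (F := H)).continuous

/-- A star projection for which every vector of the real subspace is an eigenvector is trivial. -/
lemma eq_zero_or_eq_one_of_eigenDefect (hC : IsConjugation C) {P : H →L[ℂ] H}
    (hP : IsStarProjection P) (h : ∀ x y, C x = x → eigenDefect P x y = 0) : P = 0 ∨ P = 1 := by
  have hPP : ∀ v, P (P v) = P v := fun v =>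
    congrArg (fun X : H →L[ℂ] H => X v) hP.isIdempotentElem.eq
  have h01 : ∀ x, C x = x → P x = 0 ∨ P x = x := by
    intro x hx
    -- For a projection the defect at `x, P x` is `‖P x‖² (‖x‖² - ‖P x‖²)`.
    have h1 := h x (P x) hx
    have e1 : ⟪P x, x⟫_ℂ = ⟪P x, P x⟫_ℂ := by
      rw [hP.isSelfAdjoint.inner_clm_left, hP.isSelfAdjoint.inner_clm_left, hPP]
    have e2 : ⟪x, P x⟫_ℂ = ⟪P x, P x⟫_ℂ := by
      rw [hP.isSelfAdjoint.inner_clm_left, hPP]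
    rw [eigenDefect, e1, e2, ← mul_sub] at h1
    rcases mul_eq_zero.1 h1 with h2 | h2
    · exact Or.inl (inner_self_eq_zero.1 h2)
    · right
      have : ⟪P x - x, P x - x⟫_ℂ = 0 := by
        rw [inner_sub_left, inner_sub_right, inner_sub_right, e1, e2]
        linear_combination h2
      exact sub_eq_zero.1 (inner_self_eq_zero.1 this)
  by_cases hz : ∀ x, C x = x → P x = 0
  · exact Or.inl (clm_ext_of_real hC hz)
  · push Not at hz
    obtain ⟨a, ha, hPa⟩ := hz
    have hPa' := (h01 a ha).resolve_left hPa
    refine Or.inr (clm_ext_of_real hC fun x hx => ?_)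
    rcases h01 x hx with h0 | h1
    -- If `P` fixes `a ≠ 0` and kills `x`, the real vector `a + x` is fixed or killed only when `x =
    -- 0`.
    · rcases h01 (a + x) (by rw [map_add, ha, hx]) with h2 | h2
      · rw [map_add, h0, add_zero] at h2
        exact (hPa h2).elim
      · rw [map_add, h0, add_zero, hPa'] at h2
        have : x = 0 := by simpa using h2
        simp [this]
    · exact h1

/-- Every complex symmetric operator on a separable Hilbert space is an arbitrarily small compact
perturbation of an irreducible complex symmetric operator. -/
theorem exists_compact_perturbation_irreducible [TopologicalSpace.SeparableSpace H]
    (hC : IsConjugation C) {T : H →L[ℂ] H} (hT : IsSymmetricFor C T) {ε : ℝ} (hε : 0 < ε) :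
    ∃ K : H →L[ℂ] H, IsCompactOperator K ∧ ‖K‖ < ε ∧ IsSymmetricFor C (T + K) ∧
      IsIrreducible (T + K) := by
  let s : Set (H →L[ℂ] H) := {K | IsCompactOperator K} ∩ {K | IsSymmetricFor C K}
  have hs : IsClosed s := isClosed_setOfPred_isCompactOperator.inter (isClosed_isSymmetricFor hC)
  have : CompleteSpace s := hs.completeSpace_coe
  let z := TopologicalSpace.denseSeq H
  have hz : DenseRange z := TopologicalSpace.denseRange_denseSeq H
  have hreal : ∀ v, C (v + C v) = v + C v := fun v => by rw [map_add, hC.involutive, add_comm]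
  let O : ℕ × ℕ × ℕ → Set s := fun q => {K | ∀ D : H →L[ℂ] H, ‖D‖ ≤ 1 → IsSelfAdjoint D →
    Commute D (T + (K : H →L[ℂ] H)) →
      ‖eigenDefect D (z q.1 + C (z q.1)) (z q.2.1)‖ < 1 / ((q.2.2 : ℝ) + 1)}
  have hO : ∀ q, IsOpen (O q) := fun q =>
    (isOpen_eigenDefect_lt (z q.1 + C (z q.1)) (z q.2.1) (1 / ((q.2.2 : ℝ) + 1))).preimage
      (continuous_const.add continuous_subtype_val)
  have hd : ∀ q, Dense (O q) := by
    intro q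
    rw [Metric.dense_iff]
    intro K r hr
    obtain ⟨K', hK'c, hK's, hK'r, hK'⟩ := exists_compact_perturbation_eigenvector hC
      (hT.add K.2.2) (z q.1 + C (z q.1)) (hreal _) hr
    refine ⟨⟨K + K', IsCompactOperator.add K.2.1 hK'c, IsSymmetricFor.add K.2.2 hK's⟩, ?_, ?_⟩
    · rw [Metric.mem_ball, Subtype.dist_eq, dist_eq_norm]
      simpa using hK'r
    · intro D _ hD hcomm
      obtain ⟨c, hc⟩ := hK' D hD (by rwa [add_assoc])
      rw [eigenDefect_eq_zero hc, norm_zero]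
      positivity
  have h0 : (0 : H →L[ℂ] H) ∈ s := by
    refine ⟨isCompactOperator_zero, fun x => ?_⟩
    simp
  obtain ⟨K, hKε, hK⟩ := (Metric.dense_iff.1 (dense_iInter_of_isOpen hO hd)) ⟨0, h0⟩ ε hε
  refine ⟨K, K.2.1, ?_, hT.add K.2.2, ?_⟩
  · rw [Metric.mem_ball, Subtype.dist_eq, dist_eq_norm] at hKε
    simpa using hKε
  · intro P hP hcomm
    have hP1 : ‖P‖ ≤ 1 := hP.norm_le
    refine eq_zero_or_eq_one_of_eigenDefect hC hP ?_
    have hzero : ∀ m p, eigenDefect P (z m + C (z m)) (z p) = 0 := by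
      intro m p
      by_contra hne
      obtain ⟨n, hn⟩ := exists_nat_one_div_lt (norm_pos_iff.2 hne)
      exact absurd (Set.mem_iInter.1 hK (m, p, n) P hP1 hP.isSelfAdjoint hcomm) hn.not_gt
    have hcont : Continuous fun v : H × H => eigenDefect P (v.1 + C v.1) v.2 := by
      have := hC.continuous
      unfold eigenDefect
      fun_prop
    have hall := hcont.ext_on (hz.prodMap hz) (continuous_const (y := (0 : ℂ))) (by
      rintro _ ⟨⟨m, p⟩, rfl⟩
      exact hzero m p)
    intro x y hx
    -- A real `x` is `v + C v` for `v = x / 2`.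
    have h1 := congrFun hall ((1 / 2 : ℝ) • x, y)
    simp only [map_real_smul, hx, ← add_smul] at h1
    norm_num at h1
    exact h1

end Irreducible

end CSO

theorem proposition3p8 {H : Type*} [NormedAddCommGroup H] [InnerProductSpace ℂ H]
    [CompleteSpace H] (T : H →L[ℂ] H) (hT : CSO.IsComplexSymmetric T)
    (hshift : CSO.IsWeightedShift T) (ε : ℝ) (hε : 0 < ε) :
    ∃ K : H →L[ℂ] H, IsCompactOperator K ∧ ‖K‖ < ε ∧
      CSO.IsComplexSymmetric (T + K) ∧ CSO.IsIrreducible (T + K) := by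
  have : TopologicalSpace.SeparableSpace H := by
    rcases hshift with ⟨e, -⟩ | ⟨e, -⟩
    exacts [CSO.separableSpace_of_hilbertBasis e, CSO.separableSpace_of_hilbertBasis e]
  obtain ⟨C, hC, hCT⟩ := hT
  obtain ⟨K, hKc, hKε, hKs, hKi⟩ := CSO.exists_compact_perturbation_irreducible hC hCT hε
  exact ⟨K, hKc, hKε, ⟨C, hC, hKs⟩, hKi⟩
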